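/- Let $\Sigma$ be an alphabet (a set of letters), let $n\ge 2$, and let $\Xi=\{x_1,\dots,x_n\}$ be a set of $n$ unknowns. A (coefficient-free) word equation $E: u=v$ on $n$ unknowns is a pair of words $u,v\in\Xi^*$; it is trivial if $u$ and $v$ are the same word, and $|E|_x$ denotes the number of occurrences of the unknown $x$ in $uv$. A solution of $E$ is a morphism $h:\Xi^*\to\Sigma^*$ with $h(u)=h(v)$. The rank of a morphism $h:\Xi^*\to\Sigma^*$ is the smallest $r$ for which there is a set $A\subseteq\Sigma^*$ of $r$ words with $h(x)\in A^*$ for every $x\in\Xi$, and the length type of $h$ is the vector $(|h(x_1)|,\dots,|h(x_n)|)\in\mathbb{N}_0^n\subset\mathbb{Q}^n$. Let $\mathrm{Sol}_{n-1}(E_1,\dots,E_i)$ denote the set of common solutions of $E_1,\dots,E_i$ of rank $n-1$. Let $m\ge 1$ and let $E_1,\dots,E_m$ be nontrivial equations on $n$ unknowns such that $$\mathrm{Sol}_{n-1}(E_1)\supsetneq \mathrm{Sol}_{n-1}(E_1,E_2)\supsetneq\dots\supsetneq \mathrm{Sol}_{n-1}(E_1,\dots,E_m)\neq\varnothing .$$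 Then the following hold. (1) If $m\ge 2$ and the set of length types of the elements of $\mathrm{Sol}_{n-1}(E_1,E_2)$ is covered by a union of $N$ $(n-1)$-dimensional subspaces of $\mathbb{Q}^n$, then $m\le N+1$. (2) There are two distinct unknowns $x,y\in\Xi$ such that $m\le(|E_1|_x+|E_1|_y)^2+1$. -/

import Mathlib

/-- A coefficient-free word equation `lhs = rhs` on the unknowns `x_0, …, x_{n-1}`,
indexed by `Fin n`: a pair of words over the unknowns. -/
structure WordEquation (n : ℕ) where
  /-- The left-hand side. -/
  lhs : FreeMonoid (Fin n)
  /-- The right-hand side. -/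
  rhs : FreeMonoid (Fin n)

namespace WordEquation

variable {n : ℕ}

/-- An equation is trivial if its two sides are the same word. -/
def IsTrivial (E : WordEquation n) : Prop := E.lhs = E.rhs

/-- `|E|_x`: the number of occurrences of the unknown `x` in the word `lhs * rhs`. -/
def occ (E : WordEquation n) (x : Fin n) : ℕ :=
  (FreeMonoid.toList (E.lhs * E.rhs)).count x

/-- A morphism `h` into the words over the alphabet `α` is a solution of `E` if it maps
the two sides of `E` to the same word. -/
def IsSolution {α : Type*} (E : WordEquation n) (h : FreeMonoid (Fin n) →* FreeMonoid α) :
    Prop :=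
  h E.lhs = h E.rhs

end WordEquation

/-- The combinatorial rank of a morphism `h`: the least `r` such that, for some set `A` of `r`
words, all the words `h(x)` (with `x` an unknown) lie in `A^*`. -/
noncomputable def morphismRank {n : ℕ} {α : Type*}
    (h : FreeMonoid (Fin n) →* FreeMonoid α) : ℕ :=
  sInf {r : ℕ | ∃ A : Finset (FreeMonoid α), A.card = r ∧
    ∀ x : Fin n, h (FreeMonoid.of x) ∈ Submonoid.closure (A : Set (FreeMonoid α))}

/-- The length type `(|h(x_0)|, …, |h(x_{n-1})|)` of a morphism `h`. -/
def lengthType {n : ℕ} {α : Type*} (h : FreeMonoid (Fin n) →* FreeMonoid α) : Fin n → ℕ :=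
  fun x => (h (FreeMonoid.of x)).length

/-- The set of common solutions of rank `r`, with values in the words over the alphabet `α`,
of the system `S` of word equations. -/
def rankSol {n : ℕ} (α : Type*) (r : ℕ) (S : Set (WordEquation n)) :
    Set (FreeMonoid (Fin n) →* FreeMonoid α) :=
  {h | morphismRank h = r ∧ ∀ E ∈ S, E.IsSolution h}

/-!
For a length vector `L`, give the unknown `x` the weight `t ^ L(x)`. The Fox derivatives of the two
sides of an equation are then exponential sums over the occurrences of the unknowns, and words are
recovered from these sums as soon as at most one unknown has length `0`. By the chain rule, a
morphism `h` with length type `L` solves `E` if and only if the row of derivatives of `E` at `t ^ L`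
annihilates the Fox Jacobian of `h`.

Splitting off common prefixes repeatedly writes a morphism as `θ ∘ f` with `θ` injective and the
Jacobian of `f` injective at all nonvanishing weights. If `h` has rank `n - 1` and solves a
nontrivial equation, then `f` maps to the words over `n - 1` letters, and the length types of the
morphisms factoring through `f` span a hyperplane. On this hyperplane the rows of any two equations
solved by `h` annihilate the same `(n - 1)`-dimensional space, so they are proportional and their
`2 × 2` minors vanish. Conversely, if all minors of `E₁` and `E'` vanish at the length type of a
solution of the nontrivial equation `E₁`, the row of `E'` is a multiple of that of `E₁` and `E'` is
solved as well.

If finitely many proper subspaces cover the length types of all rank `n - 1` morphisms through `f`,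
then one of them contains, hence equals, the hyperplane of `f`. So if two solutions separating
different steps of the chain gave the same subspace, the first one would also solve the later
equations. This proves (1).

For (2), some minor of `E₁` and `E₂` is not identically zero. At each zero of the minor, its
positive and negative terms have the same exponents with multiplicity. Cancel common linear forms
and split the remaining ones into chains that are increasing at nonnegative `L`, one for each
occurrence of the two unknowns in `E₁`: the smallest remaining exponent on each side is attained by
the first form of a chain, so `L` lies on one of at most `(|E₁|_x + |E₁|_y) ^ 2` hyperplanes.
-/

section FoxCalculus

open FreeMonoid

variable {R β γ ι : Type*} [CommSemiring R]

/-- The Fox differential of a word `w` at the weights `c`: the linear map sending a vector `p` to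
the sum, over the factorizations `w = u a v` with `a` a letter, of `c(u) * p a`, where `c` is
extended multiplicatively to words. Its value at `Pi.single x 1` is the Fox derivative `∂w/∂x`. -/
def foxDifferential (c : β → R) (w : FreeMonoid β) : (β → R) →ₗ[R] R :=
  w.toList.foldr (fun a D => LinearMap.proj a + c a • D) 0

@[simp]
lemma foxDifferential_one (c : β → R) : foxDifferential c (1 : FreeMonoid β) = 0 := rfl

lemma foxDifferential_of_mul (c : β → R) (a : β) (w : FreeMonoid β) :
    foxDifferential c (of a * w) = LinearMap.proj a + c a • foxDifferential c w := rfl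

@[simp]
lemma foxDifferential_of (c : β → R) (a : β) : foxDifferential c (of a) = LinearMap.proj a := by
  rw [← mul_one (of a), foxDifferential_of_mul, foxDifferential_one, smul_zero, add_zero]

lemma foxDifferential_mul (c : β → R) (u v : FreeMonoid β) :
    foxDifferential c (u * v) = foxDifferential c u + lift c u • foxDifferential c v := by
  induction u using FreeMonoid.inductionOn' with
  | one => simp
  | of_mul a u ih =>
    rw [mul_assoc, foxDifferential_of_mul, foxDifferential_of_mul, ih, map_mul, lift_eval_of,
      smul_add, add_assoc, smul_smul]

/-- The matrix of the Fox derivatives of the images of the letters under `f`, at the weights `c`,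
as a linear map. -/
def foxJacobian (c : γ → R) (f : FreeMonoid β →* FreeMonoid γ) : (γ → R) →ₗ[R] (β → R) :=
  LinearMap.pi fun x => foxDifferential c (f (of x))

@[simp]
lemma foxJacobian_apply (c : γ → R) (f : FreeMonoid β →* FreeMonoid γ) (p : γ → R) (x : β) :
    foxJacobian c f p x = foxDifferential c (f (of x)) p := rfl

lemma foxDifferential_map (c : γ → R) (f : FreeMonoid β →* FreeMonoid γ) (w : FreeMonoid β) :
    foxDifferential c (f w) =
      foxDifferential (fun x => lift c (f (of x))) w ∘ₗ foxJacobian c f := by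
  induction w using FreeMonoid.inductionOn' with
  | one => simp
  | of_mul a w ih =>
    rw [map_mul, foxDifferential_mul, ih, foxDifferential_of_mul]
    rfl

lemma foxJacobian_comp (c : γ → R) (g : FreeMonoid β →* FreeMonoid γ)
    (f : FreeMonoid ι →* FreeMonoid β) :
    foxJacobian c (g.comp f) =
      foxJacobian (fun y => lift c (g (of y))) f ∘ₗ foxJacobian c g :=
  LinearMap.ext fun p => funext fun x => LinearMap.congr_fun (foxDifferential_map c g (f (of x))) p

@[simp]
lemma lift_one_apply (w : FreeMonoid β) : lift (1 : β → R) w = 1 :=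
  DFunLike.congr_fun (hom_eq (f := lift (1 : β → R)) (g := 1) fun _ => by simp) w

lemma foxJacobian_one_comp (g : FreeMonoid β →* FreeMonoid γ) (f : FreeMonoid ι →* FreeMonoid β) :
    foxJacobian (1 : γ → R) (g.comp f) = foxJacobian 1 f ∘ₗ foxJacobian 1 g := by
  simp only [foxJacobian_comp, lift_one_apply]
  rfl

lemma foxDifferential_one_one (w : FreeMonoid β) :
    foxDifferential (1 : β → R) w 1 = w.length := by
  induction w using FreeMonoid.inductionOn' with
  | one => simp
  | of_mul a w ih => simp [foxDifferential_of_mul, ih]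

lemma lift_ne_zero [NoZeroDivisors R] [Nontrivial R] {c : β → R} (hc : ∀ y, c y ≠ 0)
    (w : FreeMonoid β) : lift c w ≠ 0 := by
  induction w using FreeMonoid.inductionOn' with
  | one => simp
  | of_mul a w ih => simpa using ⟨hc a, ih⟩

end FoxCalculus

section Factorization

open FreeMonoid

variable {ι β γ α : Type*}

/-- A morphism of free monoids is Fox-injective if its Fox Jacobian is injective at all nonvanishing
weights. Injective morphisms need not have this property, nor do Fox-injective ones have to be
injective: it says that `f` has as many independent images as there are letters in the target. -/
def IsFoxInjective (f : FreeMonoid β →* FreeMonoid γ) : Prop :=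
  ∀ (K : Type) [Field K] (c : γ → K), (∀ y, c y ≠ 0) → Function.Injective (foxJacobian c f)

lemma IsFoxInjective.comp {g : FreeMonoid β →* FreeMonoid γ} {f : FreeMonoid ι →* FreeMonoid β}
    (hg : IsFoxInjective g) (hf : IsFoxInjective f) : IsFoxInjective (g.comp f) := by
  intro K _ c hc
  rw [foxJacobian_comp, LinearMap.coe_comp]
  exact (hf K _ fun y => lift_ne_zero hc _).comp (hg K c hc)

lemma isFoxInjective_of_surjOn_letters {f : FreeMonoid β →* FreeMonoid γ}
    (hf : ∀ y, ∃ x, f (of x) = of y) : IsFoxInjective f := by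
  intro K _ c _ p q hpq
  funext y
  obtain ⟨x, hx⟩ := hf y
  simpa [hx] using congrFun hpq x

lemma isFoxInjective_lift_update [DecidableEq β] {x y : β} (hxy : x ≠ y) :
    IsFoxInjective (lift (Function.update of y (of x * of y)) : FreeMonoid β →* FreeMonoid β) := by
  intro K _ c hc p q hpq
  have eq_of_ne : ∀ z, z ≠ y → p z = q z := fun z hz => by
    simpa [hz] using congrFun hpq z
  funext z
  by_cases hz : z = y
  · subst hz
    simpa [foxDifferential_mul, eq_of_ne x hxy, hc x] using congrFun hpq z
  · exact eq_of_ne z hz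

lemma injective_of_prefix_free {θ : FreeMonoid γ →* FreeMonoid α}
    (hne : ∀ y, θ (of y) ≠ 1) (hprefix : ∀ y z w, θ (of z) = θ (of y) * w → y = z) :
    Function.Injective θ := by
  have map_ne_one : ∀ a u, θ (of a * u) ≠ 1 := fun a u hu =>
    hne a (List.append_eq_nil_iff.1 ((map_mul θ _ _).symm.trans hu)).1
  intro u
  induction u using FreeMonoid.inductionOn' with
  | one =>
    intro v hv
    cases v using FreeMonoid.casesOn with
    | one => rfl
    | of_mul b v => exact absurd (hv.symm.trans (map_one θ)) (map_ne_one b v)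
  | of_mul a u ih =>
    intro v hv
    cases v using FreeMonoid.casesOn with
    | one => exact absurd (hv.trans (map_one θ)) (map_ne_one a u)
    | of_mul b v =>
      rw [map_mul, map_mul] at hv
      obtain rfl : a = b := by
        rcases List.append_eq_append_iff.1 hv with ⟨w, hw, _⟩ | ⟨w, hw, _⟩
        · exact hprefix a b w hw
        · exact (hprefix b a w hw).symm
      rw [ih (mul_left_cancel hv)]

lemma exists_erasing_factorization (h : FreeMonoid ι →* FreeMonoid α) :
    ∃ f : FreeMonoid ι →* FreeMonoid {x // h (of x) ≠ 1},
      (lift fun y : {x // h (of x) ≠ 1} => h (of y.1)).comp f = h ∧ IsFoxInjective f := by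
  classical
  refine ⟨lift fun x => if hx : h (of x) ≠ 1 then of ⟨x, hx⟩ else 1, hom_eq fun x => ?_,
    isFoxInjective_of_surjOn_letters fun y => ⟨y.1, by simp [y.2]⟩⟩
  by_cases hx : h (of x) = 1 <;> simp [hx]

lemma exists_shorter_factorization [Fintype ι] (h : FreeMonoid ι →* FreeMonoid α) {x y : ι}
    {w : FreeMonoid α} (hxy : x ≠ y) (hx : h (of x) ≠ 1) (hy : h (of y) = h (of x) * w) :
    ∃ (φ : FreeMonoid ι →* FreeMonoid ι) (h' : FreeMonoid ι →* FreeMonoid α), h'.comp φ = h ∧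
      IsFoxInjective φ ∧ ∑ z, (h' (of z)).length < ∑ z, (h (of z)).length := by
  classical
  refine ⟨_, lift (Function.update (fun z => h (of z)) y w), hom_eq fun z => ?_,
    isFoxInjective_lift_update hxy,
    Finset.sum_lt_sum (fun z _ => ?_) ⟨y, Finset.mem_univ y, ?_⟩⟩
  · by_cases hz : z = y
    · subst hz; simp [hxy, hy]
    · simp [hz]
  · by_cases hz : z = y
    · subst hz; simp [hy]
    · simp [hz]
  · have : 0 < (h (of x)).length := Nat.pos_of_ne_zero fun h0 => hx (length_eq_zero.1 h0)
    simpa [hy] using this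

theorem exists_foxInjective_factorization {ι : Type} [Finite ι]
    (h : FreeMonoid ι →* FreeMonoid α) :
    ∃ (Y : Type) (_ : Fintype Y) (f : FreeMonoid ι →* FreeMonoid Y)
      (θ : FreeMonoid Y →* FreeMonoid α),
      θ.comp f = h ∧ Function.Injective θ ∧ IsFoxInjective f := by
  classical
  have := Fintype.ofFinite ι
  induction hN : ∑ x, (h (of x)).length using Nat.strong_induction_on generalizing h with
  | _ N ih =>
  by_cases hreducible : ∃ x y w, x ≠ y ∧ h (of x) ≠ 1 ∧ h (of y) = h (of x) * w
  · obtain ⟨x, y, w, hxy, hx, hy⟩ := hreducible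
    obtain ⟨φ, h', rfl, hφ, hlt⟩ := exists_shorter_factorization h hxy hx hy
    obtain ⟨Y, _, f, θ, rfl, hθ, hf⟩ := ih _ (hN ▸ hlt) h' rfl
    exact ⟨Y, inferInstance, f.comp φ, θ, rfl, hθ, hf.comp hφ⟩
  · push Not at hreducible
    obtain ⟨f, hθf, hf⟩ := exists_erasing_factorization h
    refine ⟨{x // h (of x) ≠ 1}, inferInstance, f, _, hθf,
      injective_of_prefix_free (fun y => ?_) fun y z w hw => ?_, hf⟩
    · simpa only [lift_eval_of] using y.2
    · by_contra hyz
      exact hreducible y.1 z.1 w (Subtype.coe_injective.ne hyz) y.2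
        (by simpa only [lift_eval_of] using hw)

end Factorization

section Rank

open FreeMonoid

variable {n : ℕ} {α Y : Type*}

lemma morphismRank_le {h : FreeMonoid (Fin n) →* FreeMonoid α} {A : Finset (FreeMonoid α)}
    (hA : ∀ x, h (of x) ∈ Submonoid.closure (A : Set (FreeMonoid α))) : morphismRank h ≤ A.card :=
  Nat.sInf_le ⟨A, rfl, hA⟩

lemma morphismRank_comp_le [Fintype Y] (f : FreeMonoid (Fin n) →* FreeMonoid Y)
    (θ : FreeMonoid Y →* FreeMonoid α) : morphismRank (θ.comp f) ≤ Fintype.card Y := by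
  classical
  refine (morphismRank_le (A := Finset.univ.image fun y => θ (of y)) fun x => ?_).trans
    Finset.card_image_le
  rw [MonoidHom.comp_apply]
  induction f (of x) using FreeMonoid.inductionOn' with
  | one => simp
  | of_mul a u ih =>
    rw [map_mul]
    exact mul_mem (Submonoid.subset_closure (by simp)) ih

lemma exists_factorization_through_morphismRank (h : FreeMonoid (Fin n) →* FreeMonoid α) :
    ∃ (f : FreeMonoid (Fin n) →* FreeMonoid (Fin (morphismRank h)))
      (θ : FreeMonoid (Fin (morphismRank h)) →* FreeMonoid α), θ.comp f = h := by
  classical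
  have nonempty : {r : ℕ | ∃ A : Finset (FreeMonoid α), A.card = r ∧
      ∀ x, h (of x) ∈ Submonoid.closure (A : Set (FreeMonoid α))}.Nonempty :=
    ⟨_, Finset.univ.image fun x => h (of x), rfl, fun _ => Submonoid.subset_closure (by simp)⟩
  obtain ⟨A, hcard, hA⟩ := Nat.sInf_mem nonempty
  let e : A ≃ Fin (morphismRank h) := A.equivFinOfCardEq hcard
  let θ : FreeMonoid (Fin (morphismRank h)) →* FreeMonoid α := lift fun i => (e.symm i).1
  have closure_le : Submonoid.closure (A : Set (FreeMonoid α)) ≤ MonoidHom.mrange θ :=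
    Submonoid.closure_le.2 fun w hw =>
      ⟨of (e ⟨w, hw⟩), by simp [θ]⟩
  choose f hf using fun x => closure_le (hA x)
  exact ⟨lift f, θ, hom_eq fun x => by simp [hf]⟩

lemma morphismRank_le_card (h : FreeMonoid (Fin n) →* FreeMonoid α) [Fintype α] :
    morphismRank h ≤ Fintype.card α :=
  morphismRank_comp_le h (MonoidHom.id _)

lemma finrank_range_foxJacobian_le (h : FreeMonoid (Fin n) →* FreeMonoid α) :
    Module.finrank ℚ (LinearMap.range (foxJacobian (1 : α → ℚ) h)) ≤ morphismRank h := by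
  obtain ⟨f, θ, hθf⟩ := exists_factorization_through_morphismRank h
  calc Module.finrank ℚ (LinearMap.range (foxJacobian (1 : α → ℚ) h))
      ≤ Module.finrank ℚ (LinearMap.range
          (foxJacobian (1 : Fin (morphismRank h) → ℚ) f)) := by
        conv_lhs => rw [← hθf, foxJacobian_one_comp]
        exact Submodule.finrank_mono (LinearMap.range_comp_le_range _ _)
    _ ≤ morphismRank h := (LinearMap.finrank_range_le _).trans (by simp)

lemma nonempty_embedding_of_card_le_morphismRank [Fintype Y]
    (h : FreeMonoid (Fin n) →* FreeMonoid α) (hY : Fintype.card Y ≤ morphismRank h) :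
    Nonempty (Y ↪ α) := by
  cases finite_or_infinite α
  · have := Fintype.ofFinite α
    exact Function.Embedding.nonempty_of_card_le (hY.trans (morphismRank_le_card h))
  · exact ⟨(Fintype.equivFin Y).toEmbedding.trans
      (Fin.valEmbedding.trans (Infinite.natEmbedding α))⟩

end Rank

section Lengths

open FreeMonoid Module

variable {ι α Y : Type*} {n : ℕ}

/-- The length type of a morphism, with rational entries. -/
def lengthVector (h : FreeMonoid ι →* FreeMonoid α) : ι → ℚ := fun x => (h (of x)).length

lemma lengthVector_nonneg (h : FreeMonoid ι →* FreeMonoid α) : 0 ≤ lengthVector h :=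
  fun _ => Nat.cast_nonneg _

lemma lengthVector_eq_foxJacobian (h : FreeMonoid ι →* FreeMonoid α) :
    lengthVector h = foxJacobian 1 h 1 :=
  funext fun x => (foxDifferential_one_one (h (of x))).symm

lemma lengthVector_comp (θ : FreeMonoid Y →* FreeMonoid α) (f : FreeMonoid ι →* FreeMonoid Y) :
    lengthVector (θ.comp f) = foxJacobian 1 f (lengthVector θ) := by
  rw [lengthVector_eq_foxJacobian, foxJacobian_one_comp, lengthVector_eq_foxJacobian,
    LinearMap.comp_apply]

lemma subsingleton_lengthVector_eq_zero {h : FreeMonoid (Fin n) →* FreeMonoid α}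
    (hrank : n - 1 ≤ morphismRank h) : {x | lengthVector h x = 0}.Subsingleton := by
  classical
  intro x hx y hy
  have map_eq_one : ∀ {z}, lengthVector h z = 0 → h (of z) = 1 := fun hz =>
    length_eq_zero.1 (Nat.cast_eq_zero.1 hz)
  by_contra hxy
  obtain ⟨f, hf, -⟩ := exists_erasing_factorization h
  have rank_le : morphismRank h ≤ Fintype.card {z // h (of z) ≠ 1} := by
    conv_lhs => rw [← hf]
    exact morphismRank_comp_le f _
  have card_le : Fintype.card {z // h (of z) ≠ 1} ≤ ({x, y}ᶜ : Finset (Fin n)).card := by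
    rw [Fintype.card_subtype]
    refine Finset.card_le_card fun z hz => ?_
    rw [Finset.mem_filter_univ] at hz
    simp only [Finset.mem_compl, Finset.mem_insert, Finset.mem_singleton, not_or]
    exact ⟨fun h => hz (h ▸ map_eq_one hx), fun h => hz (h ▸ map_eq_one hy)⟩
  have two_le : ({x, y} : Finset (Fin n)).card ≤ n := by
    simpa using Finset.card_le_univ ({x, y} : Finset (Fin n))
  rw [Finset.card_compl, Fintype.card_fin] at card_le
  rw [Finset.card_pair hxy] at card_le two_le
  omega

/-- The space spanned, when `Y` is finite, by the length types of the morphisms factoring through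
`f`. -/
def lengthSpace (f : FreeMonoid ι →* FreeMonoid Y) : Submodule ℚ (ι → ℚ) :=
  LinearMap.range (foxJacobian (1 : Y → ℚ) f)

lemma lengthVector_comp_mem_lengthSpace (θ : FreeMonoid Y →* FreeMonoid α)
    (f : FreeMonoid ι →* FreeMonoid Y) : lengthVector (θ.comp f) ∈ lengthSpace f :=
  ⟨_, (lengthVector_comp θ f).symm⟩

lemma IsFoxInjective.finrank_lengthSpace [Fintype Y] {f : FreeMonoid ι →* FreeMonoid Y}
    (hf : IsFoxInjective f) : finrank ℚ (lengthSpace f) = Fintype.card Y := by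
  rw [lengthSpace, LinearMap.finrank_range_of_inj (hf ℚ 1 fun _ => one_ne_zero),
    finrank_fintype_fun_eq_card]

lemma foxDifferential_one_pow (w : FreeMonoid Y) (k : ℕ) :
    foxDifferential (1 : Y → ℚ) (w ^ k) = (k : ℚ) • foxDifferential 1 w := by
  induction k with
  | zero => simp
  | succ k ih => rw [pow_succ, foxDifferential_mul, ih, lift_one_apply]; push_cast; module

/-- The morphism sending each letter `y` to the power `μ y` of the letter `e y`. -/
def powerHom (e : Y ↪ α) (μ : Y → ℕ) : FreeMonoid Y →* FreeMonoid α :=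
  lift fun y => of (e y) ^ μ y

lemma lengthVector_powerHom (e : Y ↪ α) (μ : Y → ℕ) :
    lengthVector (powerHom e μ) = fun y => (μ y : ℚ) := by
  funext y
  rw [lengthVector_eq_foxJacobian]
  simp [powerHom, foxDifferential_one_pow]

lemma range_foxJacobian_powerHom {e : Y ↪ α} {μ : Y → ℕ} (hμ : ∀ y, 0 < μ y) :
    LinearMap.range (foxJacobian (1 : α → ℚ) (powerHom e μ)) = ⊤ := by
  refine LinearMap.range_eq_top.2 fun q => ⟨Function.extend e (fun y => q y / μ y) 0, ?_⟩
  funext y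
  simp [powerHom, foxDifferential_one_pow, e.injective.extend_apply, mul_div_cancel₀,
    (hμ y).ne']

lemma IsFoxInjective.morphismRank_powerHom_comp [Fintype Y]
    {f : FreeMonoid (Fin n) →* FreeMonoid Y} (hf : IsFoxInjective f) {e : Y ↪ α} {μ : Y → ℕ}
    (hμ : ∀ y, 0 < μ y) : morphismRank ((powerHom e μ).comp f) = Fintype.card Y := by
  refine le_antisymm (morphismRank_comp_le _ _) ?_
  rw [← hf.finrank_lengthSpace, lengthSpace,
    ← LinearMap.range_comp_of_range_eq_top _ (range_foxJacobian_powerHom (e := e) hμ),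
    ← foxJacobian_one_comp]
  exact finrank_range_foxJacobian_le _

open MvPolynomial in
lemma exists_pos_natCast_notMem [Finite Y] (𝒲 : Finset (Submodule ℚ (Y → ℚ)))
    (h𝒲 : ∀ W ∈ 𝒲, W ≠ ⊤) :
    ∃ μ : Y → ℕ, (∀ y, 0 < μ y) ∧ ∀ W ∈ 𝒲, (fun y => (μ y : ℚ)) ∉ W := by
  classical
  have := Fintype.ofFinite Y
  choose! φ hφ hker using fun (W : Submodule ℚ (Y → ℚ)) (hW : W ∈ 𝒲) =>
    W.exists_le_ker_of_lt_top (h𝒲 W hW).lt_top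
  let P : Submodule ℚ (Y → ℚ) → MvPolynomial Y ℚ := fun W =>
    ∑ y, X y * C (φ W fun z => if y = z then 1 else 0)
  have eval_P : ∀ W v, eval v (P W) = φ W v := fun W v => by
    rw [(φ W).pi_apply_eq_sum_univ v]
    simp [P]
  have prod_ne_zero : ∏ W ∈ 𝒲, P W ≠ 0 := Finset.prod_ne_zero_iff.2 fun W hW hP =>
    hφ W hW (LinearMap.ext fun v => by rw [← eval_P, hP, map_zero, LinearMap.zero_apply])
  by_contra! hcover
  refine prod_ne_zero (funext_set (fun _ => Set.range fun k : ℕ => ((k + 1 : ℕ) : ℚ))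
    (fun _ => Set.infinite_range_of_injective fun a b hab => by simpa using hab) fun v hv => ?_)
  choose μ hμ using fun y => hv y (Set.mem_univ y)
  obtain ⟨W, hW, hmem⟩ := hcover (fun y => μ y + 1) fun y => (μ y).succ_pos
  rw [map_zero, map_prod]
  refine Finset.prod_eq_zero hW ?_
  rw [eval_P, ← funext hμ]
  exact hker W hW hmem

lemma IsFoxInjective.exists_lengthSpace_le [Fintype Y] {f : FreeMonoid (Fin n) →* FreeMonoid Y}
    (hf : IsFoxInjective f) (e : Y ↪ α) {𝒱 : Finset (Submodule ℚ (Fin n → ℚ))}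
    (h𝒱 : ∀ g : FreeMonoid Y →* FreeMonoid α, morphismRank (g.comp f) = Fintype.card Y →
      ∃ V ∈ 𝒱, lengthVector (g.comp f) ∈ V) :
    ∃ V ∈ 𝒱, lengthSpace f ≤ V := by
  classical
  by_contra! hcon
  obtain ⟨μ, hμ, hnotMem⟩ := exists_pos_natCast_notMem
    (𝒱.image (Submodule.comap (foxJacobian (1 : Y → ℚ) f))) (by
      simpa only [lengthSpace, Finset.forall_mem_image, ne_eq, ← LinearMap.range_le_iff_comap]
        using hcon)
  obtain ⟨V, hV, hmem⟩ := h𝒱 (powerHom e μ) (hf.morphismRank_powerHom_comp hμ)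
  rw [lengthVector_comp, lengthVector_powerHom] at hmem
  exact hnotMem _ (Finset.mem_image_of_mem _ hV) hmem

end Lengths

section ExponentialSums

open Module HahnSeries

variable {M : Type*} [AddCommGroup M] [Module ℚ M]

/-- The exponential sum `∑ t ^ φ(L)` of a multiset of linear forms `φ` at the vector `L`, as a Hahn
series in `t` with rational exponents. -/
noncomputable def expSum (L : M) (s : Multiset (Dual ℚ M)) : HahnSeries ℚ ℚ :=
  (s.map fun φ => single (φ L) 1).sum

@[simp]
lemma expSum_zero (L : M) : expSum L 0 = 0 := rfl

@[simp]
lemma expSum_cons (L : M) (φ : Dual ℚ M) (s : Multiset (Dual ℚ M)) :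
    expSum L (φ ::ₘ s) = single (φ L) 1 + expSum L s := by
  simp [expSum]

lemma expSum_add (L : M) (s t : Multiset (Dual ℚ M)) :
    expSum L (s + t) = expSum L s + expSum L t := by
  simp [expSum]

lemma expSum_map_add (L : M) (φ : Dual ℚ M) (s : Multiset (Dual ℚ M)) :
    expSum L (s.map (φ + ·)) = single (φ L) 1 * expSum L s := by
  induction s using Multiset.induction_on with
  | empty => simp
  | cons ψ s ih => simp [ih, mul_add, single_mul_single]

lemma coeff_expSum (L : M) (s : Multiset (Dual ℚ M)) (q : ℚ) :
    (expSum L s).coeff q = (s.map fun φ => φ L).count q := by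
  induction s using Multiset.induction_on with
  | empty => simp
  | cons φ s ih => simp [ih, Multiset.count_cons, coeff_single, add_comm]

lemma map_apply_eq_of_expSum_eq {L : M} {s t : Multiset (Dual ℚ M)}
    (hst : expSum L s = expSum L t) : s.map (fun φ => φ L) = t.map fun φ => φ L :=
  Multiset.ext.2 fun q => Nat.cast_injective (R := ℚ) <| by
    rw [← coeff_expSum, ← coeff_expSum, hst]

end ExponentialSums

section Occurrences

open FreeMonoid Module HahnSeries

variable {β : Type*}

/-- The weights `t ^ L(x)`, at which the weight of a word `w` is `t ^ L(w)`, where `L` is extended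
additively to words. -/
noncomputable def expWeight (L : β → ℚ) (x : β) : HahnSeries ℚ ℚ := single (L x) 1

lemma expWeight_ne_zero (L : β → ℚ) (x : β) : expWeight L x ≠ 0 :=
  single_ne_zero one_ne_zero

lemma lift_expWeight (L : β → ℚ) (w : FreeMonoid β) :
    lift (expWeight L) w = single (foxDifferential 1 w L) 1 := by
  induction w using FreeMonoid.inductionOn' with
  | one => simp
  | of_mul a w ih =>
    rw [map_mul, ih, lift_eval_of, expWeight, single_mul_single, mul_one, foxDifferential_of_mul]
    simp

variable [DecidableEq β]

/-- The positions of the letter `x` in the word `w`, as linear forms in the lengths of the letters: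
an occurrence `w = u x v` contributes the length of `u`. -/
def occForms (x : β) (w : FreeMonoid β) : List (Dual ℚ (β → ℚ)) :=
  w.toList.foldr
    (fun a l => (if a = x then [0] else []) ++ l.map ((LinearMap.proj a : Dual ℚ (β → ℚ)) + ·)) []

@[simp]
lemma occForms_one (x : β) : occForms x (1 : FreeMonoid β) = [] := rfl

lemma occForms_of_mul (x a : β) (w : FreeMonoid β) :
    occForms x (of a * w) =
      (if a = x then [0] else []) ++ (occForms x w).map (LinearMap.proj a + ·) := rfl

lemma length_occForms (x : β) (w : FreeMonoid β) : (occForms x w).length = w.toList.count x := by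
  induction w using FreeMonoid.inductionOn' with
  | one => rfl
  | of_mul a w ih =>
    rw [occForms_of_mul, toList_of_mul, List.count_cons, List.length_append, List.length_map, ih]
    split <;> simp_all [add_comm]

lemma nonneg_of_mem_occForms {x : β} {w : FreeMonoid β} {L : β → ℚ} (hL : 0 ≤ L) :
    ∀ φ ∈ occForms x w, 0 ≤ φ L := by
  induction w using FreeMonoid.inductionOn' with
  | one => simp
  | of_mul a w ih =>
    simp only [occForms_of_mul, List.mem_append, List.mem_map]
    rintro φ (hφ | ⟨ψ, hψ, rfl⟩)
    · split at hφ <;> simp_all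
    · exact add_nonneg (hL a) (ih ψ hψ)

lemma pairwise_occForms (x : β) (w : FreeMonoid β) {L : β → ℚ} (hL : 0 ≤ L) :
    (occForms x w).Pairwise fun φ ψ => φ L ≤ ψ L := by
  induction w using FreeMonoid.inductionOn' with
  | one => exact List.Pairwise.nil
  | of_mul a w ih =>
    have tail : ((occForms x w).map ((LinearMap.proj a : Dual ℚ (β → ℚ)) + ·)).Pairwise
        fun φ ψ => φ L ≤ ψ L :=
      ih.map _ fun _ _ hφψ => add_le_add_right hφψ (L a)
    rw [occForms_of_mul]
    split
    · refine List.Pairwise.cons (fun φ hφ => ?_) tail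
      refine nonneg_of_mem_occForms (x := x) (w := of a * w) hL φ ?_
      exact List.mem_append_right _ hφ
    · exact tail

lemma foxDifferential_expWeight_single (L : β → ℚ) (x : β) (w : FreeMonoid β) :
    foxDifferential (expWeight L) w (Pi.single x 1) = expSum L (occForms x w : Multiset _) := by
  induction w using FreeMonoid.inductionOn' with
  | one => rfl
  | of_mul a w ih =>
    rw [occForms_of_mul, ← Multiset.coe_add, ← Multiset.map_coe, expSum_add, expSum_map_add, ← ih,
      foxDifferential_of_mul]
    by_cases hax : a = x
    · subst hax; simp [expWeight, expSum]
    · simp [expWeight, hax]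

lemma exists_occForms_apply_eq_zero {L : β → ℚ} {b : β} {u v : FreeMonoid β}
    (huv : foxDifferential (expWeight L) u = foxDifferential (expWeight L) (of b * v)) :
    ∃ φ ∈ occForms b u, φ L = 0 := by
  have values_eq := LinearMap.congr_fun huv (Pi.single b 1)
  rw [foxDifferential_expWeight_single, foxDifferential_expWeight_single] at values_eq
  have zero_mem : (0 : ℚ) ∈ (occForms b u : Multiset (Dual ℚ (β → ℚ))).map fun φ => φ L := by
    rw [map_apply_eq_of_expSum_eq values_eq]
    simp [occForms_of_mul]
  simpa using zero_mem

end Occurrences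

open FreeMonoid in
lemma eq_of_foxDifferential_expWeight_eq {β : Type*} {L : β → ℚ} (hL : 0 ≤ L)
    (hzero : {x | L x = 0}.Subsingleton) {u v : FreeMonoid β}
    (huv : foxDifferential (expWeight L) u = foxDifferential (expWeight L) v) : u = v := by
  classical
  -- The derivative of `b v` with respect to `b` contains `t ^ 0`, so that of `a u` does too: some
  -- occurrence of `b` in `a u` is preceded by a prefix of length `0`, which begins with `a`.
  have weight_eq_zero : ∀ {a b u v}, a ≠ b → foxDifferential (expWeight L) (of a * u) =
      foxDifferential (expWeight L) (of b * v) → L a = 0 := fun {a b u v} hab h => by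
    obtain ⟨φ, hφ, hφL⟩ := exists_occForms_apply_eq_zero h
    simp only [occForms_of_mul, hab, if_false, List.nil_append, List.mem_map] at hφ
    obtain ⟨ψ, hψ, rfl⟩ := hφ
    exact (((add_eq_zero_iff_of_nonneg (hL a) (nonneg_of_mem_occForms hL ψ hψ)).1 hφL)).1
  induction u using FreeMonoid.inductionOn' generalizing v with
  | one =>
    cases v using FreeMonoid.casesOn with
    | one => rfl
    | of_mul b v => simpa using exists_occForms_apply_eq_zero huv
  | of_mul a u ih =>
    cases v using FreeMonoid.casesOn with
    | one => simpa using exists_occForms_apply_eq_zero huv.symm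
    | of_mul b v =>
      obtain rfl : a = b := by
        by_contra hab
        exact hab (hzero (weight_eq_zero hab huv) (weight_eq_zero (Ne.symm hab) huv.symm))
      rw [foxDifferential_of_mul, foxDifferential_of_mul, add_right_inj] at huv
      rw [ih (smul_right_injective _ (expWeight_ne_zero L a) huv)]

section LeadingExcess

variable {β γ : Type*} [DecidableEq β]

lemma map_sub_eq_map_sub {f : β → γ} {s t : Multiset β} (hst : s.map f = t.map f) :
    (s - t).map f = (t - s).map f := by
  refine add_right_cancel (b := (s ∩ t).map f) ?_
  rw [← Multiset.map_add, ← Multiset.map_add, Multiset.sub_add_inter, Multiset.inter_comm,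
    Multiset.sub_add_inter, hst]

/-- The elements that come first, in some list of `C`, among those occurring more often in all of
`C` than in `t`. -/
def leadingExcess (C : List (List β)) (t : Multiset β) : Finset β :=
  (C.filterMap fun l => l.find? fun v => t.count v < C.flatten.count v).toFinset

lemma card_leadingExcess_le (C : List (List β)) (t : Multiset β) :
    (leadingExcess C t).card ≤ C.length :=
  (List.toFinset_card_le _).trans (List.length_filterMap_le _ _)

lemma mem_sub_of_mem_leadingExcess {C : List (List β)} {t : Multiset β} {v : β}
    (hv : v ∈ leadingExcess C t) : v ∈ (C.flatten : Multiset β) - t := by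
  obtain ⟨l, -, hl⟩ := List.mem_filterMap.1 (List.mem_toFinset.1 hv)
  simpa [Multiset.mem_sub] using List.find?_some hl

lemma exists_leadingExcess_le [Preorder γ] {C : List (List β)} {val : β → γ}
    (hC : ∀ l ∈ C, l.Pairwise fun v w => val v ≤ val w) {t : Multiset β} {v : β}
    (hv : v ∈ (C.flatten : Multiset β) - t) : ∃ w ∈ leadingExcess C t, val w ≤ val v := by
  have hcount : t.count v < C.flatten.count v := by simpa [Multiset.mem_sub] using hv
  obtain ⟨l, hl, hvl⟩ := List.mem_flatten.1 (List.count_pos_iff.1 (Nat.zero_lt_of_lt hcount))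
  obtain ⟨w, hw⟩ := Option.isSome_iff_exists.1 (List.find?_isSome.2
    ⟨v, hvl, by simpa using hcount⟩ :
      (l.find? fun v => t.count v < C.flatten.count v).isSome)
  refine ⟨w, List.mem_toFinset.2 (List.mem_filterMap.2 ⟨l, hl, hw⟩), ?_⟩
  obtain ⟨-, before, after, rfl, hbefore⟩ := List.find?_eq_some_iff_append.1 hw
  rcases List.mem_append.1 hvl with hv | hv
  · exact absurd hcount (by simpa using hbefore v hv)
  · rcases List.mem_cons.1 hv with rfl | hv
    · exact le_rfl
    · exact List.rel_of_pairwise_cons (List.pairwise_append.1 (hC _ hl)).2.1 hv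

lemma exists_leadingExcess_apply_eq [LinearOrder γ] {C D : List (List β)} {val : β → γ}
    (hC : ∀ l ∈ C, l.Pairwise fun v w => val v ≤ val w)
    (hD : ∀ l ∈ D, l.Pairwise fun v w => val v ≤ val w)
    (hne : (C.flatten : Multiset β) ≠ D.flatten)
    (hval : (C.flatten : Multiset β).map val = (D.flatten : Multiset β).map val) :
    ∃ v ∈ leadingExcess C D.flatten, ∃ w ∈ leadingExcess D C.flatten, val v = val w := by
  have hsub := map_sub_eq_map_sub hval
  have below_D : ∀ v ∈ leadingExcess C D.flatten,
      ∃ w ∈ leadingExcess D C.flatten, val w ≤ val v := fun v hv => by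
    have := Multiset.mem_map_of_mem val (mem_sub_of_mem_leadingExcess hv)
    rw [hsub] at this
    obtain ⟨u, hu, hval_u⟩ := Multiset.mem_map.1 this
    exact hval_u ▸ exists_leadingExcess_le hD hu
  have below_C : ∀ w ∈ leadingExcess D C.flatten,
      ∃ v ∈ leadingExcess C D.flatten, val v ≤ val w := fun w hw => by
    have := Multiset.mem_map_of_mem val (mem_sub_of_mem_leadingExcess hw)
    rw [← hsub] at this
    obtain ⟨u, hu, hval_u⟩ := Multiset.mem_map.1 this
    exact hval_u ▸ exists_leadingExcess_le hC hu
  have nonempty : (leadingExcess C D.flatten).Nonempty := by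
    have sub_ne_zero : (C.flatten : Multiset β) - D.flatten ≠ 0 := fun h0 => hne <|
      Multiset.eq_of_le_of_card_le (tsub_eq_zero_iff_le.1 h0)
        (by simpa only [Multiset.card_map] using (congrArg Multiset.card hval).ge)
    obtain ⟨v, hv⟩ := Multiset.exists_mem_of_ne_zero sub_ne_zero
    obtain ⟨w, hw, -⟩ := exists_leadingExcess_le hC hv
    exact ⟨w, hw⟩
  obtain ⟨v, hv, hmin⟩ := Finset.exists_min_image _ val nonempty
  obtain ⟨w, hw, hwv⟩ := below_D v hv
  obtain ⟨v', hv', hv'w⟩ := below_C w hw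
  exact ⟨v, hv, w, hw, le_antisymm ((hmin v' hv').trans hv'w) hwv⟩

end LeadingExcess

section Hyperplanes

open Module

variable {M : Type*} [AddCommGroup M] [Module ℚ M]

lemma exists_finset_submodule_of_lists {C D : List (List (Dual ℚ M))}
    (hne : (C.flatten : Multiset (Dual ℚ M)) ≠ D.flatten) :
    ∃ 𝒱 : Finset (Submodule ℚ M), 𝒱.card ≤ C.length * D.length ∧ (∀ V ∈ 𝒱, V ≠ ⊤) ∧
      ∀ L : M, (∀ l ∈ C, l.Pairwise fun φ ψ => φ L ≤ ψ L) →
        (∀ l ∈ D, l.Pairwise fun φ ψ => φ L ≤ ψ L) →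
        expSum L (C.flatten : Multiset (Dual ℚ M)) = expSum L (D.flatten : Multiset (Dual ℚ M)) →
        ∃ V ∈ 𝒱, L ∈ V := by
  classical
  refine ⟨(leadingExcess C D.flatten ×ˢ leadingExcess D C.flatten).image fun p =>
    LinearMap.eqLocus p.1 p.2, ?_, ?_, fun L hC hD hL => ?_⟩
  · refine Finset.card_image_le.trans ?_
    rw [Finset.card_product]
    exact Nat.mul_le_mul (card_leadingExcess_le _ _) (card_leadingExcess_le _ _)
  · simp only [Finset.forall_mem_image, Finset.mem_product, and_imp, Prod.forall]
    intro φ ψ hφ hψ htop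
    obtain rfl : φ = ψ := LinearMap.eqLocus_eq_top.1 htop
    exact lt_asymm (Multiset.mem_sub.1 (mem_sub_of_mem_leadingExcess hφ))
      (Multiset.mem_sub.1 (mem_sub_of_mem_leadingExcess hψ))
  · obtain ⟨φ, hφ, ψ, hψ, hφψ⟩ := exists_leadingExcess_apply_eq (val := fun φ => φ L) hC hD hne
      (map_apply_eq_of_expSum_eq hL)
    exact ⟨_, Finset.mem_image_of_mem _ (Finset.mk_mem_product hφ hψ), hφψ⟩

/-- The sums of a form from `A` and one from `B`, listed as one translate of `B` for each form of
`A`, so that each list is increasing whenever `B` is. -/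
def chains (A B : List (Dual ℚ M)) : List (List (Dual ℚ M)) := A.map fun φ => B.map (φ + ·)

lemma length_chains (A B : List (Dual ℚ M)) : (chains A B).length = A.length := List.length_map _

lemma pairwise_of_mem_chains {A B l : List (Dual ℚ M)} {L : M} (hl : l ∈ chains A B)
    (hB : B.Pairwise fun φ ψ => φ L ≤ ψ L) : l.Pairwise fun φ ψ => φ L ≤ ψ L := by
  obtain ⟨φ, -, rfl⟩ := List.mem_map.1 hl
  exact hB.map _ fun _ _ h => add_le_add_right h (φ L)

lemma expSum_flatten_chains (L : M) (A B : List (Dual ℚ M)) :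
    expSum L ((chains A B).flatten : Multiset (Dual ℚ M)) =
      expSum L (A : Multiset (Dual ℚ M)) * expSum L (B : Multiset (Dual ℚ M)) := by
  induction A with
  | nil => simp [chains]
  | cons φ A ih =>
    rw [chains, List.map_cons, ← chains, List.flatten_cons, ← Multiset.coe_add, expSum_add, ih,
      ← Multiset.map_coe, expSum_map_add, ← Multiset.cons_coe, expSum_cons, add_mul]

end Hyperplanes

section LinearForms

open Module

lemma forms_proportional_of_finrank_le {K V : Type*} [Field K] [AddCommGroup V] [Module K V]
    [FiniteDimensional K V] {W : Submodule K V} (hW : finrank K V ≤ finrank K W + 1)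
    {φ ψ : Dual K V} (hφ : W ≤ LinearMap.ker φ) (hψ : W ≤ LinearMap.ker ψ) (v w : V) :
    φ v * ψ w = φ w * ψ v := by
  let χ : Dual K V := φ v • ψ - ψ v • φ
  suffices χ w = 0 by
    simpa [χ, sub_eq_zero, mul_comm (ψ v)] using this
  by_contra hχ
  have lt_top : LinearMap.ker χ < ⊤ := lt_top_iff_ne_top.2 fun htop =>
    hχ (LinearMap.mem_ker.1 (htop ▸ Submodule.mem_top))
  have ker_eq : W = LinearMap.ker χ := by
    refine Submodule.eq_of_le_of_finrank_le (fun u hu => ?_) ?_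
    · simp [χ, LinearMap.mem_ker.1 (hφ hu), LinearMap.mem_ker.1 (hψ hu)]
    · have := Submodule.finrank_lt lt_top.ne
      omega
  have mem : v ∈ W := by simp [ker_eq, χ, mul_comm]
  exact hχ (by simp [χ, LinearMap.mem_ker.1 (hφ mem), LinearMap.mem_ker.1 (hψ mem)])

end LinearForms

namespace WordEquation

open FreeMonoid Module

variable {n : ℕ} {α β Y : Type*}

/-- The difference of the Fox differentials of the two sides of `E`. -/
def differential {R : Type*} [CommRing R] (E : WordEquation n) (c : Fin n → R) :
    (Fin n → R) →ₗ[R] R :=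
  foxDifferential c E.lhs - foxDifferential c E.rhs

/-- The `2 × 2` minor, in the columns `x` and `y`, of the matrix of Fox derivatives of `E` and `E'`
at the weights `t ^ L`. -/
noncomputable def minor (E E' : WordEquation n) (L : Fin n → ℚ) (x y : Fin n) : HahnSeries ℚ ℚ :=
  E.differential (expWeight L) (Pi.single x 1) * E'.differential (expWeight L) (Pi.single y 1) -
    E.differential (expWeight L) (Pi.single y 1) * E'.differential (expWeight L) (Pi.single x 1)

variable {E E' : WordEquation n}

lemma differential_expWeight_ne_zero (hE : ¬ E.IsTrivial) {L : Fin n → ℚ} (hL : 0 ≤ L)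
    (hzero : {x | L x = 0}.Subsingleton) : E.differential (expWeight L) ≠ 0 := fun h =>
  hE (eq_of_foxDifferential_expWeight_eq hL hzero (sub_eq_zero.1 h))

lemma expWeight_lift_eq {f : FreeMonoid β →* FreeMonoid Y} (ν : Y → ℚ) :
    (fun x => lift (expWeight ν) (f (of x))) = expWeight (foxJacobian 1 f ν) :=
  funext fun _ => lift_expWeight ν _

lemma IsSolution.differential_comp_foxJacobian {f : FreeMonoid (Fin n) →* FreeMonoid Y}
    (hf : E.IsSolution f) (ν : Y → ℚ) :
    E.differential (expWeight (foxJacobian 1 f ν)) ∘ₗ foxJacobian (expWeight ν) f = 0 := by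
  rw [differential, LinearMap.sub_comp, ← expWeight_lift_eq, ← foxDifferential_map,
    ← foxDifferential_map, hf, sub_self]

lemma isSolution_of_differential_comp_foxJacobian {h : FreeMonoid (Fin n) →* FreeMonoid α}
    (hE : E.differential (expWeight (lengthVector h)) ∘ₗ foxJacobian (expWeight 1) h = 0) :
    E.IsSolution h := by
  rw [lengthVector_eq_foxJacobian, differential, LinearMap.sub_comp, ← expWeight_lift_eq,
    ← foxDifferential_map, ← foxDifferential_map, sub_eq_zero] at hE
  exact eq_of_foxDifferential_expWeight_eq (fun _ => zero_le_one)
    (fun a ha => absurd ha one_ne_zero) hE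

lemma IsSolution.of_minor_eq_zero {h : FreeMonoid (Fin n) →* FreeMonoid α}
    (hE : ¬ E.IsTrivial) (hzero : {x | lengthVector h x = 0}.Subsingleton)
    (hEh : E.IsSolution h) (hminor : ∀ x y, E.minor E' (lengthVector h) x y = 0) :
    E'.IsSolution h := by
  have hdiff := differential_expWeight_ne_zero hE (lengthVector_nonneg h) hzero
  obtain ⟨x, hx⟩ : ∃ x, E.differential (expWeight (lengthVector h)) (Pi.single x 1) ≠ 0 := by
    by_contra! hzero
    exact hdiff (LinearMap.pi_ext' fun x => LinearMap.ext_ring (by simpa using hzero x))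
  have proportional :
      E.differential (expWeight (lengthVector h)) (Pi.single x 1) •
          E'.differential (expWeight (lengthVector h)) =
        E'.differential (expWeight (lengthVector h)) (Pi.single x 1) •
          E.differential (expWeight (lengthVector h)) :=
    LinearMap.pi_ext' fun y => LinearMap.ext_ring <| by
      have := sub_eq_zero.1 (hminor x y)
      simpa [mul_comm] using this
  refine isSolution_of_differential_comp_foxJacobian ((smul_right_injective _ hx) ?_)
  change _ • _ = _ • (0 : (α → HahnSeries ℚ ℚ) →ₗ[HahnSeries ℚ ℚ] HahnSeries ℚ ℚ)
  have hzeroE := hEh.differential_comp_foxJacobian 1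
  rw [← lengthVector_eq_foxJacobian] at hzeroE
  rw [← LinearMap.smul_comp, proportional, LinearMap.smul_comp, hzeroE, smul_zero, smul_zero]

lemma IsSolution.minor_eq_zero [Fintype Y] {f : FreeMonoid (Fin n) →* FreeMonoid Y}
    (hf : IsFoxInjective f) (hcard : n ≤ Fintype.card Y + 1) (hE : E.IsSolution f)
    (hE' : E'.IsSolution f) {L : Fin n → ℚ} (hL : L ∈ lengthSpace f) (x y : Fin n) :
    E.minor E' L x y = 0 := by
  obtain ⟨ν, rfl⟩ := hL
  refine sub_eq_zero.2 (forms_proportional_of_finrank_le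
    (W := LinearMap.range (foxJacobian (expWeight ν) f)) ?_
    (LinearMap.range_le_ker_iff.2 (hE.differential_comp_foxJacobian ν))
    (LinearMap.range_le_ker_iff.2 (hE'.differential_comp_foxJacobian ν)) _ _)
  rw [LinearMap.finrank_range_of_inj (hf _ _ (expWeight_ne_zero ν))]
  simpa using hcard

lemma IsSolution.card_lt [Fintype Y] {f : FreeMonoid (Fin n) →* FreeMonoid Y}
    (hf : IsFoxInjective f) (hE : E.IsSolution f) {ν : Y → ℚ}
    (hdiff : E.differential (expWeight (foxJacobian 1 f ν)) ≠ 0) : Fintype.card Y < n := by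
  have lt_top : LinearMap.range (foxJacobian (expWeight ν) f) < ⊤ :=
    (LinearMap.range_le_ker_iff.2 (hE.differential_comp_foxJacobian ν)).trans_lt
      (lt_top_iff_ne_top.2 fun htop => hdiff (LinearMap.ker_eq_top.1 htop))
  simpa [LinearMap.finrank_range_of_inj (hf _ _ (expWeight_ne_zero ν))] using
    Submodule.finrank_lt lt_top.ne

end WordEquation

namespace WordEquation

open Module

variable {n : ℕ} (E E' : WordEquation n) (x y : Fin n)

/-- The linear forms in the positive terms of the minor of `E` and `E'` in the columns `x` and `y`,
split into lists that are increasing at nonnegative vectors: one list for each occurrence of `x` or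
`y` in `E`, however many terms come from `E'`. The negative terms are those with `x` and `y`
exchanged. -/
def posChains : List (List (Dual ℚ (Fin n → ℚ))) :=
  chains (occForms x E.lhs) (occForms y E'.lhs) ++ chains (occForms x E.rhs) (occForms y E'.rhs) ++
    (chains (occForms y E.lhs) (occForms x E'.rhs) ++ chains (occForms y E.rhs) (occForms x E'.lhs))

lemma length_posChains : (E.posChains E' x y).length = E.occ x + E.occ y := by
  simp [posChains, length_chains, length_occForms, occ, add_assoc]

lemma pairwise_of_mem_posChains {L : Fin n → ℚ} (hL : 0 ≤ L) :
    ∀ l ∈ E.posChains E' x y, l.Pairwise fun φ ψ => φ L ≤ ψ L := by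
  intro l hl
  simp only [posChains, List.mem_append] at hl
  rcases hl with (h | h) | (h | h) <;> exact pairwise_of_mem_chains h (pairwise_occForms _ _ hL)

lemma minor_eq_expSum_sub (L : Fin n → ℚ) :
    E.minor E' L x y = expSum L ((E.posChains E' x y).flatten : Multiset (Dual ℚ (Fin n → ℚ))) -
      expSum L ((E.posChains E' y x).flatten : Multiset (Dual ℚ (Fin n → ℚ))) := by
  simp only [minor, differential, posChains, List.flatten_append, ← Multiset.coe_add, expSum_add,
    expSum_flatten_chains, LinearMap.sub_apply, foxDifferential_expWeight_single]
  ring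

variable {E E' x y}

theorem exists_finset_submodule_of_minor_ne_zero {L₀ : Fin n → ℚ}
    (hL₀ : E.minor E' L₀ x y ≠ 0) :
    ∃ 𝒱 : Finset (Submodule ℚ (Fin n → ℚ)), 𝒱.card ≤ (E.occ x + E.occ y) ^ 2 ∧
      (∀ V ∈ 𝒱, V ≠ ⊤) ∧ ∀ L : Fin n → ℚ, 0 ≤ L → E.minor E' L x y = 0 → ∃ V ∈ 𝒱, L ∈ V := by
  have flatten_ne : ((E.posChains E' x y).flatten : Multiset (Dual ℚ (Fin n → ℚ))) ≠
      (E.posChains E' y x).flatten := fun h =>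
    hL₀ (by rw [minor_eq_expSum_sub, h, sub_self])
  obtain ⟨𝒱, hcard, htop, hcover⟩ := exists_finset_submodule_of_lists flatten_ne
  refine ⟨𝒱, ?_, htop, fun L hL hminor => ?_⟩
  · rwa [length_posChains, length_posChains, add_comm (E.occ y), ← sq] at hcard
  · rw [minor_eq_expSum_sub, sub_eq_zero] at hminor
    exact hcover L (pairwise_of_mem_posChains _ _ _ _ hL) (pairwise_of_mem_posChains _ _ _ _ hL)
      hminor

end WordEquation

section Systems

open FreeMonoid Module WordEquation

variable {n m r : ℕ} {α : Type*}

lemma rankSol_anti : Antitone (rankSol (n := n) α r) :=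
  fun _ _ hST _ hh => ⟨hh.1, fun E hE => hh.2 E (hST hE)⟩

lemma exists_foxInjective_factorization_of_rank {h : FreeMonoid (Fin n) →* FreeMonoid α}
    (hrank : morphismRank h = n - 1) {E : WordEquation n} (hE : ¬ E.IsTrivial)
    (hEh : E.IsSolution h) :
    ∃ (Y : Type) (_ : Fintype Y) (f : FreeMonoid (Fin n) →* FreeMonoid Y)
      (θ : FreeMonoid Y →* FreeMonoid α), Fintype.card Y + 1 = n ∧
      θ.comp f = h ∧ Function.Injective θ ∧ IsFoxInjective f := by
  obtain ⟨Y, _, f, θ, rfl, hθ, hf⟩ := exists_foxInjective_factorization h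
  have hdiff := differential_expWeight_ne_zero hE (lengthVector_nonneg (θ.comp f))
    (subsingleton_lengthVector_eq_zero hrank.ge)
  rw [lengthVector_comp] at hdiff
  have card_lt : Fintype.card Y < n := IsSolution.card_lt hf (hθ.eq_iff.1 hEh) hdiff
  have rank_le := morphismRank_comp_le f θ
  exact ⟨Y, inferInstance, f, θ, by omega, rfl, hθ, hf⟩

lemma minor_lengthVector_eq_zero {h : FreeMonoid (Fin n) →* FreeMonoid α}
    (hrank : morphismRank h = n - 1) {E E' : WordEquation n} (hE : ¬ E.IsTrivial)
    (hEh : E.IsSolution h) (hEh' : E'.IsSolution h) (x y : Fin n) :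
    E.minor E' (lengthVector h) x y = 0 := by
  obtain ⟨Y, _, f, θ, hcard, rfl, hθ, hf⟩ := exists_foxInjective_factorization_of_rank hrank hE hEh
  exact IsSolution.minor_eq_zero hf hcard.ge (hθ.eq_iff.1 hEh) (hθ.eq_iff.1 hEh')
    (lengthVector_comp_mem_lengthSpace θ f) x y

theorem exists_submodule_of_mem_rankSol {S : Set (WordEquation n)}
    {h : FreeMonoid (Fin n) →* FreeMonoid α} (hh : h ∈ rankSol α (n - 1) S)
    {E : WordEquation n} (hES : E ∈ S) (hE : ¬ E.IsTrivial)
    {𝒱 : Finset (Submodule ℚ (Fin n → ℚ))} (htop : ∀ V ∈ 𝒱, V ≠ ⊤)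
    (hcover : ∀ g ∈ rankSol α (n - 1) S, ∃ V ∈ 𝒱, lengthVector g ∈ V) :
    ∃ V ∈ 𝒱, lengthVector h ∈ V ∧
      ∀ E' ∈ S, ∀ L ∈ V, ∀ x y, E.minor E' L x y = 0 := by
  obtain ⟨hrank, hsol⟩ := hh
  obtain ⟨Y, _, f, θ, hcard, rfl, hθ, hf⟩ :=
    exists_foxInjective_factorization_of_rank hrank hE (hsol E hES)
  have isSolution_f : ∀ E' ∈ S, E'.IsSolution f := fun E' hE' => hθ.eq_iff.1 (hsol E' hE')
  obtain ⟨e⟩ := nonempty_embedding_of_card_le_morphismRank (Y := Y) (θ.comp f) (by omega)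
  obtain ⟨V, hV, hle⟩ := hf.exists_lengthSpace_le e fun g hg => hcover (g.comp f)
    ⟨by omega, fun E' hE' => congrArg g (isSolution_f E' hE')⟩
  obtain rfl : lengthSpace f = V := by
    refine Submodule.eq_of_le_of_finrank_le hle ?_
    have := Submodule.finrank_lt (htop V hV)
    rw [finrank_fin_fun] at this
    rw [hf.finrank_lengthSpace]
    omega
  exact ⟨_, hV, lengthVector_comp_mem_lengthSpace θ f, fun E' hE' L hL x y =>
    (isSolution_f E hES).minor_eq_zero hf hcard.ge (isSolution_f E' hE') hL x y⟩

lemma exists_mem_forall_notMem_of_strictAnti {β : Type*} {S : Fin m → Set β} (hS : StrictAnti S)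
    (hnonempty : ∀ i, (S i).Nonempty) (i : Fin m) : ∃ b ∈ S i, ∀ j, i < j → b ∉ S j := by
  by_cases hi : i.val + 1 < m
  · have lt_succ : i < ⟨i.val + 1, hi⟩ := i.val.lt_succ_self
    obtain ⟨b, hb, hb'⟩ := Set.exists_of_ssubset (hS lt_succ)
    exact ⟨b, hb, fun j hij hbj => hb' (hS.antitone (Nat.succ_le_of_lt hij) hbj)⟩
  · obtain ⟨b, hb⟩ := hnonempty i
    exact ⟨b, hb, fun j hij => by omega⟩

variable {E : Fin m → WordEquation n}

lemma exists_mem_rankSol_forall_notMem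
    (hchain : StrictAnti fun i => rankSol α r (E '' Set.Iic i))
    (hnonempty : (rankSol α r (Set.range E)).Nonempty) (i : Fin m) :
    ∃ h ∈ rankSol α r (E '' Set.Iic i), ∀ j, i < j → h ∉ rankSol α r (E '' Set.Iic j) :=
  exists_mem_forall_notMem_of_strictAnti hchain
    (fun _ => hnonempty.mono (rankSol_anti (Set.image_subset_range _ _))) i

theorem chain_length_le_card_add_one (hm : 2 ≤ m) (hnontrivial : ¬ (E ⟨0, by omega⟩).IsTrivial)
    (hchain : StrictAnti fun i => rankSol α (n - 1) (E '' Set.Iic i))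
    (hnonempty : (rankSol α (n - 1) (Set.range E)).Nonempty)
    {𝒱 : Finset (Submodule ℚ (Fin n → ℚ))} (htop : ∀ V ∈ 𝒱, V ≠ ⊤)
    (hcover : ∀ g ∈ rankSol α (n - 1) {E ⟨0, by omega⟩, E ⟨1, hm⟩}, ∃ V ∈ 𝒱, lengthVector g ∈ V) :
    m ≤ 𝒱.card + 1 := by
  set i₀ : Fin m := ⟨0, by omega⟩
  choose h hsol hnot using exists_mem_rankSol_forall_notMem hchain hnonempty
  have mem_image (i : Fin m) : E i₀ ∈ E '' Set.Iic i := ⟨i₀, Nat.zero_le _, rfl⟩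
  have pair_subset {i : Fin m} (hi : i₀ < i) : {E i₀, E ⟨1, hm⟩} ⊆ E '' Set.Iic i :=
    Set.pair_subset (mem_image i) ⟨⟨1, hm⟩, Nat.succ_le_of_lt hi, rfl⟩
  have exists_submodule (i : Fin m) (hi : i₀ < i) := exists_submodule_of_mem_rankSol (hsol i)
    (mem_image i) hnontrivial htop fun g hg => hcover g (rankSol_anti (pair_subset hi) hg)
  choose! V hV hmem hminor using exists_submodule
  have ne_of_lt {i j : Fin m} (hi : i₀ < i) (hij : i < j) : V i ≠ V j := fun heq =>
    hnot i j hij ⟨(hsol i).1, fun E' hE' => ((hsol i).2 _ (mem_image i)).of_minor_eq_zero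
      hnontrivial (subsingleton_lengthVector_eq_zero (hsol i).1.ge)
      (hminor j (hi.trans hij) E' hE' _ (heq ▸ hmem i hi))⟩
  have injOn : Set.InjOn V (Finset.Ioi i₀) := fun i hi j hj heq => by
    rcases lt_trichotomy i j with hij | hij | hij
    · exact absurd heq (ne_of_lt (Finset.mem_Ioi.1 hi) hij)
    · exact hij
    · exact absurd heq.symm (ne_of_lt (Finset.mem_Ioi.1 hj) hij)
  have := Finset.card_le_card_of_injOn V (fun i hi => hV i (Finset.mem_Ioi.1 hi)) injOn
  rw [Fin.card_Ioi, show i₀.val = 0 from rfl] at this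
  omega

theorem exists_ne_chain_length_le_sq (hm : 2 ≤ m) (hnontrivial : ¬ (E ⟨0, by omega⟩).IsTrivial)
    (hchain : StrictAnti fun i => rankSol α (n - 1) (E '' Set.Iic i))
    (hnonempty : (rankSol α (n - 1) (Set.range E)).Nonempty) :
    ∃ x y : Fin n, x ≠ y ∧
      m ≤ ((E ⟨0, by omega⟩).occ x + (E ⟨0, by omega⟩).occ y) ^ 2 + 1 := by
  set i₀ : Fin m := ⟨0, by omega⟩
  set i₁ : Fin m := ⟨1, hm⟩
  obtain ⟨h, ⟨hrank, hsol⟩, hnot⟩ := exists_mem_rankSol_forall_notMem hchain hnonempty i₀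
  have solves_first : (E i₀).IsSolution h := hsol _ ⟨i₀, Set.self_mem_Iic, rfl⟩
  have not_solves_second : ¬ (E i₁).IsSolution h := fun solves_second => by
    refine hnot i₁ Nat.zero_lt_one ⟨hrank, ?_⟩
    rintro _ ⟨k, hk, rfl⟩
    obtain rfl | rfl : k = i₀ ∨ k = i₁ := by
      simpa only [Fin.ext_iff] using Nat.le_one_iff_eq_zero_or_eq_one.1 hk
    exacts [solves_first, solves_second]
  obtain ⟨x, y, hxy⟩ : ∃ x y, (E i₀).minor (E i₁) (lengthVector h) x y ≠ 0 := by
    by_contra! hzero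
    exact not_solves_second (solves_first.of_minor_eq_zero hnontrivial
      (subsingleton_lengthVector_eq_zero hrank.ge) hzero)
  obtain ⟨𝒱, hcard, htop, hcover⟩ := exists_finset_submodule_of_minor_ne_zero hxy
  refine ⟨x, y, ?_, (chain_length_le_card_add_one hm hnontrivial hchain hnonempty htop fun g hg =>
    hcover _ (lengthVector_nonneg g) (minor_lengthVector_eq_zero hg.1 hnontrivial
      (hg.2 _ (.inl rfl)) (hg.2 _ (.inr rfl)) x y)).trans (Nat.add_le_add_right hcard 1)⟩
  rintro rfl
  exact hxy (by rw [minor, sub_self])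

end Systems

theorem mainTheorem1 {α : Type*} (n m : ℕ) (hn : 2 ≤ n) (hm : 1 ≤ m)
    (E : Fin m → WordEquation n)
    (hnontrivial : ∀ i, ¬ (E i).IsTrivial)
    (hchain : ∀ i j : Fin m, i < j →
      rankSol α (n - 1) (E '' Set.Iic j) ⊂ rankSol α (n - 1) (E '' Set.Iic i))
    (hnonempty : (rankSol α (n - 1) (Set.range E)).Nonempty) :
    (∀ (hm2 : 2 ≤ m) (N : ℕ) (V : Fin N → Submodule ℚ (Fin n → ℚ)),
      (∀ k, Module.finrank ℚ (V k) = n - 1) →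
      (∀ h ∈ rankSol α (n - 1) {E ⟨0, hm⟩, E ⟨1, hm2⟩},
        ∃ k, (fun x => (lengthType h x : ℚ)) ∈ V k) →
      m ≤ N + 1) ∧
    ∃ x y : Fin n, x ≠ y ∧ m ≤ ((E ⟨0, hm⟩).occ x + (E ⟨0, hm⟩).occ y) ^ 2 + 1 := by
  refine ⟨fun hm2 N V hV hcover => ?_, ?_⟩
  · have htop : ∀ W ∈ Finset.univ.image V, W ≠ ⊤ := by
      simp only [Finset.mem_image, Finset.mem_univ, true_and, forall_exists_index,
        forall_apply_eq_imp_iff]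
      intro k hk
      have := hV k
      rw [hk, finrank_top, Module.finrank_fin_fun] at this
      omega
    have hcard : (Finset.univ.image V).card ≤ N := Finset.card_image_le.trans (by simp)
    refine (chain_length_le_card_add_one hm2 (hnontrivial _) hchain hnonempty htop
      fun g hg => ?_).trans (Nat.add_le_add_right hcard 1)
    obtain ⟨k, hk⟩ := hcover g hg
    exact ⟨V k, Finset.mem_image_of_mem V (Finset.mem_univ k), hk⟩
  · rcases hm.eq_or_lt with rfl | hm2
    · exact ⟨⟨0, by omega⟩, ⟨1, by omega⟩, by simp, by simp⟩
    · exact exists_ne_chain_length_le_sq hm2 (hnontrivial _) hchain hnonempty
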